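/- **Model.** There are $n$ asynchronous processes $p_1,\dots,p_n$, of which at most $t_b\ge 0$ are Byzantine (they behave arbitrarily and may collude); the others are called correct and, in a given execution, $c$ denotes their number, so $n-t_b\le c\le n$. Processes communicate over a fully connected, authenticated, asynchronous point-to-point network that neither corrupts, duplicates nor creates messages. To *ur-broadcast* a message is to send a copy of it to each of the $n$ processes (including oneself); for every message ur-broadcast by a correct process, a message adversary may suppress up to $t_m\ge 0$ of the copies intended to correct processes, and every other copy intended to a correct process is eventually received. **Algorithm** $\mathsf{SigFreeKLCast}(q_d,q_f,\mathit{single})$, with integers $q_d,q_f\ge 0$ and a Boolean $\mathit{single}$. Each correct process executes the following code (handlers are atomic). An invocation of $\mathsf{cast}(m,id)$: if no $\mathrm{MSG}(-,id)$ has already been ur-broadcast by the process, ur-broadcast $\mathrm{MSG}(m,id)$. On reception of $\mathrm{MSG}(m,id)$: (forwarding step) if $\mathrm{MSG}(m,id)$ has been received from at least $q_f$ distinct processes and either ($\mathit{single}$ is false and $\mathrm{MSG}(m,id)$ has not already been ur-broadcast by the process) or no $\mathrm{MSG}(-,id)$ has already been ur-broadcast by the process, then ur-broadcast $\mathrm{MSG}(m,id)$;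 then (delivery step) if $\mathrm{MSG}(m,id)$ has been received from at least $q_d$ distinct processes and no $(-,id)$ has already been delivered by the process, then $\mathsf{deliver}(m,id)$. **Theorem** ($k\ell$-correctness of the signature-free algorithm). Let $\alpha=n+q_f-t_b-t_m-1$ and assume 1. $c-t_m\ge q_d\ge q_f+t_b\ge 2t_b+1$, 2. $\alpha^2-4(q_f-1)(n-t_b)\ge 0$, 3. $\alpha(q_d-1)-(q_f-1)(n-t_b)-(q_d-1)^2>0$, 4. $\alpha(q_d-1-t_b)-(q_f-1)(n-t_b)-(q_d-1-t_b)^2\ge 0$. Then every execution of $\mathsf{SigFreeKLCast}(q_d,q_f,\mathit{single})$ satisfies the following properties, for all app-messages $m$ and identities $id$: * *Validity:* if a correct process delivers $(m,id)$, then at least $k'=q_f-n+c$ correct processes cast $(m,id)$. * *No-duplication:* a correct process delivers at most one app-message with identity $id$ (and at most once). * *Conditional no-duplicity:* if $\delta=\left(q_f>\frac{n+t_b}{2}\right)\lor\left(\mathit{single}\land q_d>\frac{n+t_b}{2}\right)$ holds, then no two different correct processes deliver different app-messages with the same identity $id$. * *Local delivery:* if at least $k=\left\lfloor\frac{c(q_f-1)}{c-t_m-q_d+q_f}\right\rfloor+1$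 correct processes cast $(m,id)$ and no correct process casts an app-message $m'\ne m$ with identity $id$, then at least one correct process delivers $(m,id)$. * With $\ell=\left\lceil c\left(1-\frac{t_m}{c-q_d+1}\right)\right\rceil$: * *Weak global delivery, if $\mathit{single}$ is false:* if a correct process delivers $(m,id)$, then at least $\ell$ correct processes deliver an app-message with identity $id$ (each possibly different from $m$). * *Strong global delivery, if $\mathit{single}$ is true:* if a correct process delivers $(m,id)$ and no correct process casts an app-message $m'\ne m$ with identity $id$, then at least $\ell$ correct processes deliver $(m,id)$. -/

import Mathlib

/-! ## Computing model: asynchronous processes, Byzantine faults, message adversary -/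

namespace KLCast

/-- The effect of one atomic execution of a handler (an operation invoked by the application, or the
code triggered by a reception) of a process: the new local state, the imp-message that is
ur-broadcast (if any), and the pair `(m, id)` that is delivered to the application (if any). -/
structure HandlerResult (σ Msg M Id : Type*) where
  state : σ
  broadcast : Option Msg
  deliver : Option (M × Id)

/-- A deterministic event-driven message-passing algorithm for `n` processes, with local states in
`σ` and imp-messages in `Msg`, which exports the operations `cast` and `deliver` on app-messages
(elements of `M`) with identities (elements of `Id`). -/
structure Protocol (n : ℕ) (σ Msg M Id : Type*) where
  /-- initial local state of each process -/
  start : Fin n → σ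
  /-- code of process `p` for an invocation of `cast (m, id)` -/
  onCast : (p : Fin n) → σ → M → Id → HandlerResult σ Msg M Id
  /-- code of process `p` for the reception of an imp-message from the process `sender`
  (channels are authenticated: `p` knows the sender) -/
  onReceive : (p : Fin n) → σ → (sender : Fin n) → Msg → HandlerResult σ Msg M Id

/-- A point-to-point copy of an imp-message. -/
structure Packet (n : ℕ) (Msg : Type*) where
  src : Fin n
  dst : Fin n
  msg : Msg

/-- A global configuration: local states of the processes and copies in transit. -/
structure Config (n : ℕ) (σ Msg : Type*) where
  state : Fin n → σ
  network : Multiset (Packet n Msg)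

/-- The events of an execution. In `cast` and `receive`, the set `lost` is the choice of the message
adversary: the destinations whose copy is suppressed if the handler ur-broadcasts an
imp-message. -/
inductive Event (n : ℕ) (Msg M Id : Type*) where
  /-- nothing happens -/
  | idle
  /-- the correct process `p` invokes `cast (m, id)` -/
  | cast (p : Fin n) (m : M) (id : Id) (lost : Finset (Fin n))
  /-- the packet `pkt` is received by its (correct) destination -/
  | receive (pkt : Packet n Msg) (lost : Finset (Fin n))
  /-- the Byzantine process `pkt.src` sends the packet `pkt` -/
  | byzantineSend (pkt : Packet n Msg)

/-- The copies put in the network when `p` ur-broadcasts `msg` (that is, sends it to all `n`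
processes, itself included), and the copies for the processes of `lost` are suppressed. -/
def copies {n : ℕ} {Msg : Type*} (p : Fin n) (lost : Finset (Fin n)) :
    Option Msg → Multiset (Packet n Msg)
  | none => 0
  | some msg => (Finset.univ \ lost).val.map (fun q => ⟨p, q, msg⟩)

/-- The configuration reached from local states `st` and network content `net` when `p` completes
a handler with result `r`. -/
def afterHandler {n : ℕ} {σ Msg M Id : Type*} (st : Fin n → σ) (net : Multiset (Packet n Msg))
    (p : Fin n) (r : HandlerResult σ Msg M Id) (lost : Finset (Fin n)) : Config n σ Msg :=
  ⟨Function.update st p r.state, net + copies p lost r.broadcast⟩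

/-- `Step P C tm s e s'`: the event `e` leads from `s` to `s'`, when the set of correct processes is
`C` and the message adversary can suppress, for each ur-broadcast by a correct process, up to `tm`
copies intended to correct processes. -/
def Step {n : ℕ} {σ Msg M Id : Type*} (P : Protocol n σ Msg M Id) (C : Finset (Fin n)) (tm : ℕ)
    (s : Config n σ Msg) : Event n Msg M Id → Config n σ Msg → Prop
  | .idle, s' => s' = s
  | .cast p m id lost, s' =>
      p ∈ C ∧ lost ⊆ C ∧ lost.card ≤ tm ∧
        s' = afterHandler s.state s.network p (P.onCast p (s.state p) m id) lost
  | .receive pkt lost, s' =>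
      pkt.dst ∈ C ∧ lost ⊆ C ∧ lost.card ≤ tm ∧
        ∃ rest, s.network = pkt ::ₘ rest ∧
          s' = afterHandler s.state rest pkt.dst
            (P.onReceive pkt.dst (s.state pkt.dst) pkt.src pkt.msg) lost
  | .byzantineSend pkt, s' =>
      pkt.src ∉ C ∧ s' = ⟨s.state, pkt ::ₘ s.network⟩

/-- The executions of `P` with set `C` of correct processes and a message adversary of power `tm`.
The network neither corrupts, duplicates nor creates imp-messages, and each copy sent by a correct
process to a correct process that the adversary does not suppress is eventually received, after an
arbitrary finite delay. The Byzantine processes send arbitrary imp-messages to arbitrary processes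
at arbitrary times, under their own identity. -/
structure Execution {n : ℕ} {σ Msg M Id : Type*} (P : Protocol n σ Msg M Id)
    (C : Finset (Fin n)) (tm : ℕ) where
  config : ℕ → Config n σ Msg
  event : ℕ → Event n Msg M Id
  config_zero : config 0 = ⟨P.start, 0⟩
  step : ∀ t, Step P C tm (config t) (event t) (config (t + 1))
  fair : ∀ t pkt, pkt ∈ (config t).network → pkt.src ∈ C → pkt.dst ∈ C →
    ∃ t', t ≤ t' ∧ ∃ lost, event t' = .receive pkt lost

/-! ## The abstraction -/

/-- What the application sees: `cast t p m id` (resp. `deliver t p m id`) means that process `p`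
casts (resp. delivers) the app-message `m` with identity `id` at step `t`. -/
structure History (n : ℕ) (M Id : Type*) where
  cast : ℕ → Fin n → M → Id → Prop
  deliver : ℕ → Fin n → M → Id → Prop

/-- The handler run at an event, if any, with the process that runs it and its result. -/
def handlerRun {n : ℕ} {σ Msg M Id : Type*} (P : Protocol n σ Msg M Id) (s : Config n σ Msg) :
    Event n Msg M Id → Option (Fin n × HandlerResult σ Msg M Id)
  | .idle => none
  | .cast p m id _ => some (p, P.onCast p (s.state p) m id)
  | .receive pkt _ =>
      some (pkt.dst, P.onReceive pkt.dst (s.state pkt.dst) pkt.src pkt.msg)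
  | .byzantineSend _ => none

/-- The history of an execution. -/
def Execution.history {n : ℕ} {σ Msg M Id : Type*} {P : Protocol n σ Msg M Id}
    {C : Finset (Fin n)} {tm : ℕ} (e : Execution P C tm) : History n M Id where
  cast t p m id := ∃ lost, e.event t = .cast p m id lost
  deliver t p m id :=
    ∃ r, handlerRun P (e.config t) (e.event t) = some (p, r) ∧ r.deliver = some (m, id)

section Properties

variable {n : ℕ} {M Id : Type*} (H : History n M Id) (C : Finset (Fin n))

/-- If a correct process delivers `(m, id)`, at least `k'` correct processes cast `(m, id)`. -/
def Validity (k' : ℤ) : Prop :=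
  ∀ p ∈ C, ∀ t m id, H.deliver t p m id →
    k' ≤ (({q | q ∈ C ∧ ∃ u, H.cast u q m id} : Set (Fin n)).ncard : ℤ)

/-- A correct process delivers at most once an app-message with a given identity. -/
def NoDuplication : Prop :=
  ∀ p ∈ C, ∀ t t' m m' id, H.deliver t p m id → H.deliver t' p m' id → t = t' ∧ m = m'

/-- If `δ`, no two different correct processes deliver different app-messages with the same
identity. -/
def ConditionalNoDuplicity (δ : Prop) : Prop :=
  δ → ∀ p ∈ C, ∀ q ∈ C, p ≠ q → ∀ t t' m m' id,
    H.deliver t p m id → H.deliver t' q m' id → m = m'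

/-- No correct process casts an app-message other than `m` with identity `id`. -/
def NoConflictingCast (m : M) (id : Id) : Prop :=
  ∀ q ∈ C, ∀ t m', H.cast t q m' id → m' = m

/-- If at least `k` correct processes cast `(m, id)` and no correct process casts `m' ≠ m` with
identity `id`, at least one correct process delivers `(m, id)`. -/
def LocalDelivery (k : ℤ) : Prop :=
  ∀ m id, k ≤ (({q | q ∈ C ∧ ∃ t, H.cast t q m id} : Set (Fin n)).ncard : ℤ) →
    NoConflictingCast H C m id → ∃ p ∈ C, ∃ t, H.deliver t p m id

/-- If a correct process delivers an app-message with identity `id`, at least `l` correct processes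
deliver an app-message with identity `id`. -/
def WeakGlobalDelivery (l : ℤ) : Prop :=
  ∀ p ∈ C, ∀ t m id, H.deliver t p m id →
    l ≤ (({q | q ∈ C ∧ ∃ u m', H.deliver u q m' id} : Set (Fin n)).ncard : ℤ)

/-- If a correct process delivers `(m, id)` and no correct process casts `m' ≠ m` with identity
`id`, at least `l` correct processes deliver `(m, id)`. -/
def StrongGlobalDelivery (l : ℤ) : Prop :=
  ∀ p ∈ C, ∀ t m id, H.deliver t p m id → NoConflictingCast H C m id →
    l ≤ (({q | q ∈ C ∧ ∃ u, H.deliver u q m id} : Set (Fin n)).ncard : ℤ)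

end Properties

/-! ## The signature-free algorithm -/

/-- The local state of a process: the imp-messages received so far, as triples
`(sender, m, id)`, those ur-broadcast so far, and the pairs delivered so far. -/
structure LocalState (n : ℕ) (M Id : Type*) where
  received : Set (Fin n × M × Id)
  urBroadcast : Set (M × Id)
  delivered : Set (M × Id)

/-- The number of distinct processes from which `(m, id)` has been received. -/
noncomputable def LocalState.numReceived {n : ℕ} {M Id : Type*} (s : LocalState n M Id) (m : M)
    (id : Id) : ℕ :=
  ({j | (j, m, id) ∈ s.received} : Set (Fin n)).ncard

open Classical in
/-- The operation `cast (m, id)`. -/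
noncomputable def sfCast {n : ℕ} {M Id : Type*} (s : LocalState n M Id) (m : M) (id : Id) :
    HandlerResult (LocalState n M Id) (M × Id) M Id :=
  if ∀ m', (m', id) ∉ s.urBroadcast then
    ⟨{ s with urBroadcast := insert (m, id) s.urBroadcast }, some (m, id), none⟩
  else ⟨s, none, none⟩

open Classical in
/-- Forwarding step: new state, and imp-message ur-broadcast, if any. -/
noncomputable def sfForward {n : ℕ} {M Id : Type*} (qf : ℕ) (single : Bool)
    (s : LocalState n M Id) (m : M) (id : Id) : LocalState n M Id × Option (M × Id) :=
  if qf ≤ s.numReceived m id ∧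
      ((single = false ∧ (m, id) ∉ s.urBroadcast) ∨ ∀ m', (m', id) ∉ s.urBroadcast) then
    ({ s with urBroadcast := insert (m, id) s.urBroadcast }, some (m, id))
  else (s, none)

open Classical in
/-- Delivery step: new state, and pair delivered, if any. -/
noncomputable def sfDeliver {n : ℕ} {M Id : Type*} (qd : ℕ)
    (s : LocalState n M Id) (m : M) (id : Id) : LocalState n M Id × Option (M × Id) :=
  if qd ≤ s.numReceived m id ∧ ∀ m', (m', id) ∉ s.delivered then
    ({ s with delivered := insert (m, id) s.delivered }, some (m, id))
  else (s, none)

/-- Reception of `(m, id)` from `sender`: forwarding step, then delivery step. -/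
noncomputable def sfReceive {n : ℕ} {M Id : Type*} (qd qf : ℕ) (single : Bool)
    (s : LocalState n M Id) (sender : Fin n) (m : M) (id : Id) :
    HandlerResult (LocalState n M Id) (M × Id) M Id :=
  let s₁ : LocalState n M Id := { s with received := insert (sender, m, id) s.received }
  let f := sfForward qf single s₁ m id
  let d := sfDeliver qd f.1 m id
  ⟨d.1, f.2, d.2⟩

/-- The signature-free algorithm with delivery threshold `qd`, forwarding threshold `qf` and
Boolean `single`. The pair `(m, id)` stands for the imp-message `MSG(m, id)`. -/
noncomputable def SigFreeKLCast (n : ℕ) (M Id : Type*) (qd qf : ℕ) (single : Bool) :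
    Protocol n (LocalState n M Id) (M × Id) M Id where
  start _ := ⟨∅, ∅, ∅⟩
  onCast _ s m id := sfCast s m id
  onReceive _ s sender msg := sfReceive qd qf single s sender msg.1 msg.2

/-- `α = n + q_f - t_b - t_m - 1`. -/
def sfAlpha (n tb tm qf : ℕ) : ℤ := (n : ℤ) + qf - tb - tm - 1

end KLCast

namespace KLCast

/-! ### Effect of the handlers on a local state -/

section Handlers

variable {n : ℕ} {M Id : Type*}

/-! Fix an identity and write `c` for the number of correct processes. The safety part follows
causality. A correct process receives at most `n - c` copies of `MSG(m, id)` from Byzantine senders,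
and its other copies come from correct processes that ur-broadcast earlier. Hence, unless every
correct ur-broadcaster is itself an effective caster, some forwarder heard only effective casters
among correct processes, which forces at least `qf - (n - c)` of them (`broadcasters_subset_or`).
This gives validity. It also gives no-duplicity, since effective casters of distinct messages are
disjoint and two such sets do not fit in `C`; with `single`, ur-broadcasters take their place, with
threshold `qd`.

The liveness part is a double count of pairs (correct ur-broadcaster, correct receiver). Let `x` be
the number of correct ur-broadcasters and `l` the number of correct processes hearing at least `qd`
of them. Each ur-broadcaster reaches at least `c - tm` correct processes; a process that never
ur-broadcasts hears at most `qf - 1` of them, and a non-quorum process at most `qd - 1`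
(`card_mul_le_quorum`). With `l = 0` this bounds `x` below the local delivery threshold. After a
delivery, `x ≥ qd - tb`; a quadratic inequality excludes the gap up to `qd - 1`
(`le_card_of_quadratic`), and the bound on `l` is then weakest at `x = c`, where it is the announced
value (`ceil_le_of_quorum`). -/

theorem sfCast_received (s : LocalState n M Id) (m : M) (id : Id) :
    (sfCast s m id).state.received = s.received := by
  unfold sfCast; split_ifs <;> rfl

theorem sfCast_delivered (s : LocalState n M Id) (m : M) (id : Id) :
    (sfCast s m id).state.delivered = s.delivered := by
  unfold sfCast; split_ifs <;> rfl

theorem sfCast_deliver (s : LocalState n M Id) (m : M) (id : Id) :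
    (sfCast s m id).deliver = none := by
  unfold sfCast; split_ifs <;> rfl

theorem sfCast_urBroadcast_subset (s : LocalState n M Id) (m : M) (id : Id) :
    s.urBroadcast ⊆ (sfCast s m id).state.urBroadcast := by
  unfold sfCast; split_ifs
  · exact Set.subset_insert _ _
  · exact subset_rfl

theorem exists_mem_urBroadcast_sfCast (s : LocalState n M Id) (m : M) (id : Id) :
    ∃ m', (m', id) ∈ (sfCast s m id).state.urBroadcast := by
  unfold sfCast; split_ifs with h
  · exact ⟨m, Set.mem_insert _ _⟩
  · simpa using h

theorem sfCast_new (s : LocalState n M Id) (m : M) (id : Id) {x : M × Id}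
    (h : x ∈ (sfCast s m id).state.urBroadcast) (h' : x ∉ s.urBroadcast) :
    x = (m, id) ∧ (∀ m', (m', id) ∉ s.urBroadcast) ∧ (sfCast s m id).broadcast = some x := by
  unfold sfCast at h ⊢
  split_ifs at h ⊢ with hc
  · rcases h with h | h
    · exact ⟨h, hc, by rw [h]⟩
    · exact absurd h h'
  · exact absurd h h'

theorem sfCast_broadcast_mem (s : LocalState n M Id) (m : M) (id : Id) {x : M × Id}
    (h : (sfCast s m id).broadcast = some x) : x ∈ (sfCast s m id).state.urBroadcast := by
  unfold sfCast at h ⊢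
  split_ifs at h ⊢ with hc
  simp only [Option.some.injEq] at h
  subst h; exact Set.mem_insert _ _

variable (qd qf : ℕ) (single : Bool)

-- Forwarding changes neither `received` nor `delivered`, so both steps test the same count `N`,
-- which includes the copy just received, and the delivery test can be read on the original state.
open Classical in
theorem sfReceive_eq (s : LocalState n M Id) (j : Fin n) (m : M) (id : Id) :
    sfReceive qd qf single s j m id =
      let N := ({i | (i, m, id) ∈ insert (j, m, id) s.received} : Set (Fin n)).ncard
      let F := qf ≤ N ∧
        ((single = false ∧ (m, id) ∉ s.urBroadcast) ∨ ∀ m', (m', id) ∉ s.urBroadcast)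
      let D := qd ≤ N ∧ ∀ m', (m', id) ∉ s.delivered
      ⟨⟨insert (j, m, id) s.received,
        if F then insert (m, id) s.urBroadcast else s.urBroadcast,
        if D then insert (m, id) s.delivered else s.delivered⟩,
        if F then some (m, id) else none, if D then some (m, id) else none⟩ := by
  extract_lets N F D
  have hf : sfForward qf single { s with received := insert (j, m, id) s.received } m id =
      (⟨insert (j, m, id) s.received,
        if F then insert (m, id) s.urBroadcast else s.urBroadcast, s.delivered⟩,
        if F then some (m, id) else none) := by
    unfold sfForward
    by_cases h : F
    · rw [if_pos h, if_pos h]; exact if_pos h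
    · rw [if_neg h, if_neg h]; exact if_neg h
  have hd : ∀ U, sfDeliver qd (⟨insert (j, m, id) s.received, U, s.delivered⟩ :
      LocalState n M Id) m id = (⟨insert (j, m, id) s.received, U,
        if D then insert (m, id) s.delivered else s.delivered⟩,
        if D then some (m, id) else none) := by
    intro U
    unfold sfDeliver
    by_cases h : D
    · rw [if_pos h, if_pos h]; exact if_pos h
    · rw [if_neg h, if_neg h]; exact if_neg h
  unfold sfReceive
  dsimp only
  rw [hf]
  dsimp only
  rw [hd]

theorem sfReceive_received (s : LocalState n M Id) (j : Fin n) (m : M) (id : Id) :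
    (sfReceive qd qf single s j m id).state.received = insert (j, m, id) s.received := by
  rw [sfReceive_eq]

theorem sfReceive_urBroadcast_subset (s : LocalState n M Id) (j : Fin n) (m : M) (id : Id) :
    s.urBroadcast ⊆ (sfReceive qd qf single s j m id).state.urBroadcast := by
  rw [sfReceive_eq]; dsimp only
  split_ifs <;> first | exact subset_rfl | exact Set.subset_insert _ _

theorem sfReceive_delivered_subset (s : LocalState n M Id) (j : Fin n) (m : M) (id : Id) :
    s.delivered ⊆ (sfReceive qd qf single s j m id).state.delivered := by
  rw [sfReceive_eq]; dsimp only
  split_ifs <;> first | exact subset_rfl | exact Set.subset_insert _ _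

theorem sfReceive_new (s : LocalState n M Id) (j : Fin n) (m : M) (id : Id) {x : M × Id}
    (h : x ∈ (sfReceive qd qf single s j m id).state.urBroadcast) (h' : x ∉ s.urBroadcast) :
    x = (m, id) ∧ qf ≤ (sfReceive qd qf single s j m id).state.numReceived m id ∧
      (single = false ∨ ∀ m', (m', id) ∉ s.urBroadcast) ∧
      (sfReceive qd qf single s j m id).broadcast = some x := by
  unfold LocalState.numReceived
  rw [sfReceive_received]
  rw [sfReceive_eq] at *
  dsimp only at *
  split_ifs at h ⊢ with h1
  · rcases h with h | h
    · exact ⟨h, h1.1, h1.2.imp_left And.left, by rw [h]⟩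
    · exact absurd h h'
  · exact absurd h h'

theorem sfReceive_broadcast_mem (s : LocalState n M Id) (j : Fin n) (m : M) (id : Id) {x : M × Id}
    (h : (sfReceive qd qf single s j m id).broadcast = some x) :
    x ∈ (sfReceive qd qf single s j m id).state.urBroadcast := by
  rw [sfReceive_eq] at *
  dsimp only at *
  split_ifs at h ⊢
  simp only [Option.some.injEq] at h
  subst h
  exact Set.mem_insert _ _

theorem sfReceive_forwarded (s : LocalState n M Id) (j : Fin n) (m : M) (id : Id)
    (h : qf ≤ (sfReceive qd qf single s j m id).state.numReceived m id) :
    (single = false → (m, id) ∈ (sfReceive qd qf single s j m id).state.urBroadcast) ∧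
      ∃ m', (m', id) ∈ (sfReceive qd qf single s j m id).state.urBroadcast := by
  unfold LocalState.numReceived at h
  rw [sfReceive_received] at h
  rw [sfReceive_eq]
  dsimp only
  split_ifs with h1
  · exact ⟨fun _ => Set.mem_insert _ _, m, Set.mem_insert _ _⟩
  · have h2 := not_and.1 h1 h
    push Not at h2
    exact h2

theorem sfReceive_exists_delivered (s : LocalState n M Id) (j : Fin n) (m : M) (id : Id)
    (h : qd ≤ (sfReceive qd qf single s j m id).state.numReceived m id) :
    ∃ m', (m', id) ∈ (sfReceive qd qf single s j m id).state.delivered := by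
  unfold LocalState.numReceived at h
  rw [sfReceive_received] at h
  rw [sfReceive_eq]
  dsimp only
  split_ifs with h1
  · exact ⟨m, Set.mem_insert _ _⟩
  · have h2 := not_and.1 h1 h
    push Not at h2
    exact h2

theorem sfReceive_deliver (s : LocalState n M Id) (j : Fin n) (m : M) (id : Id) {x : M × Id}
    (h : (sfReceive qd qf single s j m id).deliver = some x) :
    x = (m, id) ∧ qd ≤ (sfReceive qd qf single s j m id).state.numReceived m id ∧
      (∀ m', (m', id) ∉ s.delivered) ∧
      x ∈ (sfReceive qd qf single s j m id).state.delivered := by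
  unfold LocalState.numReceived
  rw [sfReceive_received]
  rw [sfReceive_eq] at *
  dsimp only at *
  split_ifs at h ⊢ with h1
  simp only [Option.some.injEq] at h
  subst h
  exact ⟨rfl, h1.1, h1.2, Set.mem_insert _ _⟩

theorem sfReceive_deliver_of_new (s : LocalState n M Id) (j : Fin n) (m : M) (id : Id) {x : M × Id}
    (h : x ∈ (sfReceive qd qf single s j m id).state.delivered) (h' : x ∉ s.delivered) :
    (sfReceive qd qf single s j m id).deliver = some x := by
  rw [sfReceive_eq] at *
  dsimp only at *
  split_ifs at h ⊢
  · rcases h with h | h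
    · rw [h]
    · exact absurd h h'
  · exact absurd h h'

theorem numReceived_eq_of_ne {s s' : LocalState n M Id} {j : Fin n} {m m' : M} {id id' : Id}
    (h : s'.received = insert (j, m, id) s.received) (hne : (m', id') ≠ (m, id)) :
    s'.numReceived m' id' = s.numReceived m' id' := by
  unfold LocalState.numReceived
  congr 1
  ext i
  simp only [h, Set.mem_ofPred_eq, Set.mem_insert_iff, Prod.mk.injEq]
  simp only [ne_eq, Prod.mk.injEq] at hne
  tauto

end Handlers

/-! ### Executions -/

section Executions

variable {n : ℕ} {M Id : Type*} {qd qf tm : ℕ} {single : Bool} {C : Finset (Fin n)}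
  (e : Execution (SigFreeKLCast n M Id qd qf single) C tm)

/-- The transitions of the local state of `p`. -/
theorem state_cases (t : ℕ) (p : Fin n) :
    (e.config (t + 1)).state p = (e.config t).state p ∨
    (∃ m id lost, e.event t = .cast p m id lost ∧ p ∈ C ∧ lost.card ≤ tm ∧
      (e.config (t + 1)).state p = (sfCast ((e.config t).state p) m id).state ∧
      (e.config (t + 1)).network = (e.config t).network +
        copies p lost (sfCast ((e.config t).state p) m id).broadcast) ∨
    (∃ j m id lost, e.event t = .receive ⟨j, p, (m, id)⟩ lost ∧ p ∈ C ∧ lost.card ≤ tm ∧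
      (⟨j, p, (m, id)⟩ : Packet n (M × Id)) ∈ (e.config t).network ∧
      (e.config (t + 1)).state p =
        (sfReceive qd qf single ((e.config t).state p) j m id).state ∧
      ∃ rest, (e.config (t + 1)).network = rest +
        copies p lost (sfReceive qd qf single ((e.config t).state p) j m id).broadcast) := by
  have hs := e.step t
  generalize hev : e.event t = ev at hs ⊢
  cases ev with
  | idle => left; rw [show e.config (t + 1) = e.config t from hs]
  | byzantineSend pkt => left; rw [hs.2]
  | cast p' m id lost =>
    obtain ⟨hp, hl, hlc, hs⟩ := hs
    by_cases h : p = p'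
    · subst h
      right; left
      refine ⟨m, id, lost, rfl, hp, hlc, ?_, ?_⟩
      · rw [hs]; simp [afterHandler, SigFreeKLCast]
      · rw [hs]; rfl
    · left; rw [hs]; simp [afterHandler, h]
  | receive pkt lost =>
    obtain ⟨hp, hl, hlc, rest, hrest, hs⟩ := hs
    by_cases h : p = pkt.dst
    · subst h
      right; right
      refine ⟨pkt.src, pkt.msg.1, pkt.msg.2, lost, rfl, hp, hlc, ?_, ?_, rest, ?_⟩
      · rw [hrest]; exact Multiset.mem_cons_self _ _
      · rw [hs]; simp [afterHandler, SigFreeKLCast]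
      · rw [hs]; rfl
    · left; rw [hs]; simp [afterHandler, h]

/-! ### Monotonicity of local states and provenance of messages -/

theorem received_mono (p : Fin n) : Monotone fun t => ((e.config t).state p).received := by
  refine monotone_nat_of_le_succ fun t => ?_
  rcases state_cases e t p with h | ⟨m, id, lost, -, -, -, h, -⟩ | ⟨j, m, id, lost, -, -, -, -, h, -⟩
  · simp only [h]; exact le_rfl
  · simp only [h, sfCast_received]; exact le_rfl
  · simp only [h, sfReceive_received]; exact Set.subset_insert _ _

theorem urBroadcast_mono (p : Fin n) : Monotone fun t => ((e.config t).state p).urBroadcast := by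
  refine monotone_nat_of_le_succ fun t => ?_
  rcases state_cases e t p with h | ⟨m, id, lost, -, -, -, h, -⟩ | ⟨j, m, id, lost, -, -, -, -, h, -⟩
  · simp only [h]; exact le_rfl
  · simp only [h]; exact sfCast_urBroadcast_subset _ _ _
  · simp only [h]; exact sfReceive_urBroadcast_subset _ _ _ _ _ _ _

theorem delivered_mono (p : Fin n) : Monotone fun t => ((e.config t).state p).delivered := by
  refine monotone_nat_of_le_succ fun t => ?_
  rcases state_cases e t p with h | ⟨m, id, lost, -, -, -, h, -⟩ | ⟨j, m, id, lost, -, -, -, -, h, -⟩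
  · simp only [h]; exact le_rfl
  · simp only [h, sfCast_delivered]; exact le_rfl
  · simp only [h]; exact sfReceive_delivered_subset _ _ _ _ _ _ _

/-- The start of an ur-broadcast: it stems from an invocation of `cast` or from the forwarding
step, and all copies but `tm` are put in the network. -/
theorem new_urBroadcast {t : ℕ} {p : Fin n} {m : M} {id : Id}
    (h : (m, id) ∈ ((e.config (t + 1)).state p).urBroadcast)
    (h' : (m, id) ∉ ((e.config t).state p).urBroadcast) :
    p ∈ C ∧
    (((∃ lost, e.event t = .cast p m id lost) ∧
        ∀ m', (m', id) ∉ ((e.config t).state p).urBroadcast) ∨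
      (qf ≤ ((e.config (t + 1)).state p).numReceived m id ∧
        (single = false ∨ ∀ m', (m', id) ∉ ((e.config t).state p).urBroadcast))) ∧
    ∃ lost : Finset (Fin n), lost.card ≤ tm ∧
      ∀ q ∉ lost, (⟨p, q, (m, id)⟩ : Packet n (M × Id)) ∈ (e.config (t + 1)).network := by
  have key : ∀ (lost : Finset (Fin n)) (q : Fin n), q ∉ lost →
      (⟨p, q, (m, id)⟩ : Packet n (M × Id)) ∈ copies p lost (some (m, id)) := by
    intro lost q hq
    exact Multiset.mem_map_of_mem _ (Finset.mem_sdiff.2 ⟨Finset.mem_univ q, hq⟩)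
  rcases state_cases e t p with hs | ⟨m₁, id₁, lost, hev, hp, hl, hs, hn⟩ |
    ⟨j, m₁, id₁, lost, hev, hp, hl, -, hs, rest, hn⟩
  · rw [hs] at h; exact absurd h h'
  · rw [hs] at h
    obtain ⟨hx, hno, hb⟩ := sfCast_new _ _ _ h h'
    simp only [Prod.mk.injEq] at hx
    obtain ⟨rfl, rfl⟩ := hx
    refine ⟨hp, Or.inl ⟨⟨lost, hev⟩, hno⟩, lost, hl, fun q hq => ?_⟩
    rw [hn, hb]
    exact Multiset.mem_add.2 (Or.inr (key lost q hq))
  · rw [hs] at h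
    obtain ⟨hx, hr, hno, hb⟩ := sfReceive_new _ _ _ _ _ _ _ h h'
    simp only [Prod.mk.injEq] at hx
    obtain ⟨rfl, rfl⟩ := hx
    refine ⟨hp, Or.inr ⟨by rw [hs]; exact hr, hno⟩, lost, hl, fun q hq => ?_⟩
    rw [hn, hb]
    exact Multiset.mem_add.2 (Or.inr (key lost q hq))

theorem exists_new_of_mem {α : Type*} (s : ℕ → Set α) (h0 : s 0 = ∅) {x : α} {t : ℕ}
    (h : x ∈ s t) : ∃ u, u < t ∧ x ∈ s (u + 1) ∧ x ∉ s u := by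
  induction t with
  | zero => simp [h0] at h
  | succ t ih =>
    by_cases hx : x ∈ s t
    · obtain ⟨u, hu, h1⟩ := ih hx
      exact ⟨u, by omega, h1⟩
    · exact ⟨t, by omega, h, hx⟩

theorem start_state (p : Fin n) : (e.config 0).state p = ⟨∅, ∅, ∅⟩ := by
  rw [e.config_zero]; rfl

/-- Byzantine processes inject packets only under their own identity, so a new packet with a correct
source can only be a copy made by a handler of that source. -/
theorem network_step {t : ℕ} {pkt : Packet n (M × Id)}
    (h : pkt ∈ (e.config (t + 1)).network) (hC : pkt.src ∈ C) :
    pkt ∈ (e.config t).network ∨ pkt.msg ∈ ((e.config (t + 1)).state pkt.src).urBroadcast := by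
  have key : ∀ (p : Fin n) (lost : Finset (Fin n)) (b : Option (M × Id)),
      pkt ∈ copies p lost b → pkt.src = p ∧ b = some pkt.msg := by
    intro p lost b hb
    cases b with
    | none => simp [copies] at hb
    | some msg =>
      simp only [copies, Multiset.mem_map] at hb
      obtain ⟨q, -, rfl⟩ := hb
      exact ⟨rfl, rfl⟩
  have hs := e.step t
  generalize e.event t = ev at hs
  cases ev with
  | idle => left; rwa [show e.config (t + 1) = e.config t from hs] at h
  | byzantineSend pkt' =>
    left
    rw [hs.2] at h
    rcases Multiset.mem_cons.1 h with rfl | h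
    · exact absurd hC hs.1
    · exact h
  | cast p m id lost =>
    obtain ⟨hp, hl, hlc, hs⟩ := hs
    rw [hs] at h ⊢
    rcases Multiset.mem_add.1 h with h | h
    · exact Or.inl h
    · obtain ⟨rfl, hb⟩ := key _ _ _ h
      right
      simp only [afterHandler, Function.update_self]
      exact sfCast_broadcast_mem _ _ _ hb
  | receive pkt' lost =>
    obtain ⟨hp, hl, hlc, rest, hrest, hs⟩ := hs
    rw [hs] at h ⊢
    rcases Multiset.mem_add.1 h with h | h
    · left; rw [hrest]; exact Multiset.mem_cons_of_mem h
    · obtain ⟨h1, hb⟩ := key _ _ _ h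
      right
      rw [h1]
      simp only [afterHandler, Function.update_self]
      exact sfReceive_broadcast_mem _ _ _ _ _ _ _ hb

theorem mem_urBroadcast_of_mem_network {t : ℕ} {pkt : Packet n (M × Id)}
    (h : pkt ∈ (e.config t).network) (hC : pkt.src ∈ C) :
    pkt.msg ∈ ((e.config t).state pkt.src).urBroadcast := by
  induction t with
  | zero => rw [e.config_zero] at h; simp at h
  | succ t ih =>
    rcases network_step e h hC with h | h
    · exact urBroadcast_mono e _ (Nat.le_succ t) (ih h)
    · exact h

/-- An imp-message received from a correct process has been ur-broadcast by that process. -/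
theorem mem_urBroadcast_of_received {t : ℕ} {p q : Fin n} {m : M} {id : Id} (hq : q ∈ C)
    (h : (q, m, id) ∈ ((e.config t).state p).received) :
    ∃ u < t, (m, id) ∈ ((e.config u).state q).urBroadcast := by
  obtain ⟨u, hut, h1, h2⟩ := exists_new_of_mem (fun t => ((e.config t).state p).received)
    (by simp only [start_state]) h
  refine ⟨u, hut, ?_⟩
  rcases state_cases e u p with hs | ⟨m₁, id₁, lost, -, -, -, hs, -⟩ |
    ⟨j, m₁, id₁, lost, -, -, -, hmem, hs, -⟩
  · rw [hs] at h1; exact absurd h1 h2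
  · rw [hs, sfCast_received] at h1; exact absurd h1 h2
  · rw [hs, sfReceive_received] at h1
    rcases h1 with h1 | h1
    · simp only [Prod.mk.injEq] at h1
      obtain ⟨rfl, rfl, rfl⟩ := h1
      exact mem_urBroadcast_of_mem_network e hmem hq
    · exact absurd h1 h2

/-- The count for `(m, id)` changes only when that very message is received, and the same handler
then runs the forwarding test. With `single`, an earlier message with the same identity may block
forwarding, hence only some `m'` in general. Positivity of `qf` rules out the initial state. -/
theorem forwarded_of_numReceived (hqf : 1 ≤ qf) {t : ℕ} {p : Fin n} {m : M} {id : Id}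
    (h : qf ≤ ((e.config t).state p).numReceived m id) :
    (single = false → (m, id) ∈ ((e.config t).state p).urBroadcast) ∧
      ∃ m', (m', id) ∈ ((e.config t).state p).urBroadcast := by
  induction t with
  | zero => rw [start_state] at h; simp [LocalState.numReceived] at h; omega
  | succ t ih =>
    have old : qf ≤ ((e.config t).state p).numReceived m id →
        (single = false → (m, id) ∈ ((e.config (t + 1)).state p).urBroadcast) ∧
        ∃ m', (m', id) ∈ ((e.config (t + 1)).state p).urBroadcast := fun h =>
      ⟨fun hs => urBroadcast_mono e p (Nat.le_succ t) ((ih h).1 hs),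
        (ih h).2.imp fun _ hm => urBroadcast_mono e p (Nat.le_succ t) hm⟩
    rcases state_cases e t p with hs | ⟨m₁, id₁, lost, -, -, -, hs, -⟩ |
      ⟨j, m₁, id₁, lost, -, -, -, hmem, hs, -⟩
    · rw [hs] at h; exact old h
    · apply old
      rw [hs] at h
      simpa only [LocalState.numReceived, sfCast_received] using h
    · rw [hs] at h
      by_cases hx : (m, id) = (m₁, id₁)
      · simp only [Prod.mk.injEq] at hx
        obtain ⟨rfl, rfl⟩ := hx
        rw [hs]
        exact sfReceive_forwarded _ _ _ _ _ _ _ h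
      · exact old (by rwa [numReceived_eq_of_ne (sfReceive_received _ _ _ _ _ _ _) hx] at h)

theorem exists_delivered_of_numReceived (hqd : 1 ≤ qd) {t : ℕ} {p : Fin n} {m : M} {id : Id}
    (h : qd ≤ ((e.config t).state p).numReceived m id) :
    ∃ m', (m', id) ∈ ((e.config t).state p).delivered := by
  induction t with
  | zero => rw [start_state] at h; simp [LocalState.numReceived] at h; omega
  | succ t ih =>
    have old : qd ≤ ((e.config t).state p).numReceived m id →
        ∃ m', (m', id) ∈ ((e.config (t + 1)).state p).delivered := fun h =>
      (ih h).imp fun _ hm => delivered_mono e p (Nat.le_succ t) hm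
    rcases state_cases e t p with hs | ⟨m₁, id₁, lost, -, -, -, hs, -⟩ |
      ⟨j, m₁, id₁, lost, -, -, -, hmem, hs, -⟩
    · rw [hs] at h; exact old h
    · apply old
      rw [hs] at h
      simpa only [LocalState.numReceived, sfCast_received] using h
    · rw [hs] at h
      by_cases hx : (m, id) = (m₁, id₁)
      · simp only [Prod.mk.injEq] at hx
        obtain ⟨rfl, rfl⟩ := hx
        rw [hs]
        exact sfReceive_exists_delivered _ _ _ _ _ _ _ h
      · exact old (by rwa [numReceived_eq_of_ne (sfReceive_received _ _ _ _ _ _ _) hx] at h)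

/-- With `single`, a process ur-broadcasts at most one imp-message with a given identity. -/
theorem urBroadcast_unique (hsingle : single = true) {t : ℕ} {p : Fin n} {m m' : M} {id : Id}
    (h : (m, id) ∈ ((e.config t).state p).urBroadcast)
    (h' : (m', id) ∈ ((e.config t).state p).urBroadcast) : m = m' := by
  induction t with
  | zero => simp [start_state] at h
  | succ t ih =>
    -- With `single`, both origins of an ur-broadcast require that none with this identity has
    -- occurred.
    have fresh : ∀ m₁, (m₁, id) ∈ ((e.config (t + 1)).state p).urBroadcast →
        (m₁, id) ∉ ((e.config t).state p).urBroadcast →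
        ∀ m₂, (m₂, id) ∉ ((e.config t).state p).urBroadcast := by
      intro m₁ h1 h2
      rcases (new_urBroadcast e h1 h2).2.1 with h3 | h3
      · exact h3.2
      · exact h3.2.resolve_left (by simp [hsingle])
    by_cases h1 : (m, id) ∈ ((e.config t).state p).urBroadcast
    · by_cases h2 : (m', id) ∈ ((e.config t).state p).urBroadcast
      · exact ih h1 h2
      · exact absurd h1 (fresh _ h' h2 _)
    -- Both messages are now new at the same step, but one handler inserts only one pair.
    · have h2 := fresh _ h h1 m'
      rcases state_cases e t p with hs | ⟨m₁, id₁, lost, -, -, -, hs, -⟩ |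
        ⟨j, m₁, id₁, lost, -, -, -, hmem, hs, -⟩
      · rw [hs] at h; exact absurd h h1
      · rw [hs] at h h'
        have e1 := (sfCast_new _ _ _ h h1).1
        have e2 := (sfCast_new _ _ _ h' h2).1
        rw [← e2] at e1
        exact (Prod.mk.inj e1).1
      · rw [hs] at h h'
        have e1 := (sfReceive_new _ _ _ _ _ _ _ h h1).1
        have e2 := (sfReceive_new _ _ _ _ _ _ _ h' h2).1
        rw [← e2] at e1
        exact (Prod.mk.inj e1).1

/-- A delivery, seen from the local states. -/
theorem deliver_spec {t : ℕ} {p : Fin n} {m : M} {id : Id} (h : e.history.deliver t p m id) :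
    p ∈ C ∧ qd ≤ ((e.config (t + 1)).state p).numReceived m id ∧
      (∀ m', (m', id) ∉ ((e.config t).state p).delivered) ∧
      (m, id) ∈ ((e.config (t + 1)).state p).delivered := by
  obtain ⟨r, hr, hd⟩ := h
  have hs := e.step t
  generalize e.event t = ev at hs hr
  cases ev with
  | idle => simp [handlerRun] at hr
  | byzantineSend pkt' => simp [handlerRun] at hr
  | cast p' m' id' lost =>
    simp only [handlerRun, Option.some.injEq, Prod.mk.injEq] at hr
    obtain ⟨rfl, rfl⟩ := hr
    exact absurd hd (by simp [SigFreeKLCast, sfCast_deliver])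
  | receive pkt lost =>
    simp only [handlerRun, Option.some.injEq, Prod.mk.injEq] at hr
    obtain ⟨rfl, rfl⟩ := hr
    obtain ⟨hp, hl, hlc, rest, hrest, hs⟩ := hs
    rw [hs]
    simp only [afterHandler, Function.update_self]
    obtain ⟨h1, h2, h3, h4⟩ := sfReceive_deliver _ _ _ _ _ _ _ hd
    rw [h1] at h4
    obtain ⟨rfl, rfl⟩ := Prod.mk.inj h1
    exact ⟨hp, h2, h3, h4⟩

theorem exists_deliver_of_mem_delivered {t : ℕ} {p : Fin n} {m : M} {id : Id}
    (h : (m, id) ∈ ((e.config t).state p).delivered) : ∃ u, e.history.deliver u p m id := by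
  obtain ⟨u, -, h1, h2⟩ := exists_new_of_mem (fun t => ((e.config t).state p).delivered)
    (by simp only [start_state]) h
  refine ⟨u, ?_⟩
  rcases state_cases e u p with hs | ⟨m₁, id₁, lost, -, -, -, hs, -⟩ |
    ⟨j, m₁, id₁, lost, hev, -, -, -, hs, -⟩
  · rw [hs] at h1; exact absurd h1 h2
  · rw [hs, sfCast_delivered] at h1; exact absurd h1 h2
  · rw [hs] at h1
    refine ⟨sfReceive qd qf single ((e.config u).state p) j m₁ id₁, ?_,
      sfReceive_deliver_of_new _ _ _ _ _ _ _ h1 h2⟩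
    rw [hev]; rfl

theorem deliver_unique {p : Fin n} {t t' : ℕ} {m m' : M} {id : Id}
    (h : e.history.deliver t p m id) (h' : e.history.deliver t' p m' id) : t = t' ∧ m = m' := by
  have ht : t = t' := by
    by_contra hne
    rcases lt_or_gt_of_ne hne with hlt | hlt
    · exact (deliver_spec e h').2.2.1 m (delivered_mono e p hlt (deliver_spec e h).2.2.2)
    · exact (deliver_spec e h).2.2.1 m' (delivered_mono e p hlt (deliver_spec e h').2.2.2)
  subst ht
  obtain ⟨r, hr, hd⟩ := h
  obtain ⟨r', hr', hd'⟩ := h'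
  rw [hr, Option.some.injEq, Prod.mk.injEq] at hr'
  rw [← hr'.2, hd, Option.some.injEq, Prod.mk.injEq] at hd'
  exact ⟨rfl, hd'.1⟩

/-! ### Casters and ur-broadcasters -/

open Classical in
/-- The correct processes whose invocation of `cast (m, id)` triggers an ur-broadcast. -/
noncomputable def effectiveCasters (m : M) (id : Id) : Finset (Fin n) :=
  {p ∈ C | ∃ t, (∃ lost, e.event t = .cast p m id lost) ∧
    ∀ m', (m', id) ∉ ((e.config t).state p).urBroadcast}

open Classical in
/-- The correct processes that ur-broadcast `MSG(m, id)`. -/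
noncomputable def broadcasters (m : M) (id : Id) : Finset (Fin n) :=
  {p ∈ C | ∃ t, (m, id) ∈ ((e.config t).state p).urBroadcast}

theorem effectiveCasters_subset (m : M) (id : Id) : effectiveCasters e m id ⊆ C := by
  classical exact Finset.filter_subset _ _

theorem broadcasters_subset (m : M) (id : Id) : broadcasters e m id ⊆ C := by
  classical exact Finset.filter_subset _ _

theorem effectiveCasters_card_le (m : M) (id : Id) :
    (effectiveCasters e m id).card ≤
      ({q | q ∈ C ∧ ∃ u, e.history.cast u q m id} : Set (Fin n)).ncard := by
  rw [← Set.ncard_coe_finset]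
  refine Set.ncard_le_ncard (fun p hp => ?_) (Set.toFinite _)
  simp only [effectiveCasters, Finset.coe_filter, Set.mem_ofPred_eq] at hp
  exact ⟨hp.1, hp.2.imp fun _ h => h.1⟩

/-- After any cast with identity `id`, the process has ur-broadcast something with that identity, so
no later cast with `id` is effective. This holds for either value of `single`. -/
theorem effectiveCasters_disjoint {m m' : M} (id : Id) (hne : m ≠ m') :
    Disjoint (effectiveCasters e m id) (effectiveCasters e m' id) := by
  have after : ∀ {p : Fin n} {m : M} {t : ℕ}, (∃ lost, e.event t = .cast p m id lost) →
      ∃ m', (m', id) ∈ ((e.config (t + 1)).state p).urBroadcast := by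
    rintro p m t ⟨lost, hev⟩
    have hs := e.step t
    rw [hev] at hs
    obtain ⟨-, -, -, hs⟩ := hs
    rw [hs]
    simp only [afterHandler, Function.update_self]
    exact exists_mem_urBroadcast_sfCast _ _ _
  rw [Finset.disjoint_left]
  intro p hp hp'
  simp only [effectiveCasters, Finset.mem_filter] at hp hp'
  obtain ⟨-, t, hc, hno⟩ := hp
  obtain ⟨-, t', hc', hno'⟩ := hp'
  rcases lt_trichotomy t t' with hlt | rfl | hlt
  · obtain ⟨m₁, h1⟩ := after hc
    exact hno' m₁ (urBroadcast_mono e p hlt h1)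
  · obtain ⟨lost, hc⟩ := hc
    obtain ⟨lost', hc'⟩ := hc'
    rw [hc] at hc'
    simp only [Event.cast.injEq] at hc'
    exact hne hc'.2.1
  · obtain ⟨m₁, h1⟩ := after hc'
    exact hno m₁ (urBroadcast_mono e p hlt h1)

/-- A set of senders has at most `n - c` Byzantine members. -/
theorem numReceived_le_of_correct {s : LocalState n M Id} {m : M} {id : Id} {S : Finset (Fin n)}
    (h : ∀ q ∈ C, (q, m, id) ∈ s.received → q ∈ S) :
    s.numReceived m id + C.card ≤ S.card + n := by
  classical
  have h1 : s.numReceived m id ≤ (S ∪ Cᶜ).card := by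
    rw [← Set.ncard_coe_finset]
    refine Set.ncard_le_ncard (fun q hq => ?_) (Set.toFinite _)
    by_cases hC : q ∈ C
    · simp [h q hC hq]
    · simp [hC]
  have h2 := Finset.card_union_le S Cᶜ
  have h3 := Finset.card_add_card_compl C
  rw [Fintype.card_fin] at h3
  omega

theorem mem_broadcasters_of_received {t : ℕ} {p q : Fin n} {m : M} {id : Id} (hq : q ∈ C)
    (h : (q, m, id) ∈ ((e.config t).state p).received) : q ∈ broadcasters e m id := by
  classical
  obtain ⟨u, -, hu⟩ := mem_urBroadcast_of_received e hq h
  exact Finset.mem_filter.2 ⟨hq, u, hu⟩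

/-- Either every ur-broadcast of `MSG(m, id)` by a correct process stems from its own invocation of
`cast`, or at least `qf - (n - c)` correct processes cast `(m, id)`. -/
theorem broadcasters_subset_or (m : M) (id : Id) :
    broadcasters e m id ⊆ effectiveCasters e m id ∨
      qf + C.card ≤ (effectiveCasters e m id).card + n := by
  classical
  by_contra! hcon
  obtain ⟨h1, h2⟩ := hcon
  apply h1
  suffices H : ∀ t, ∀ p ∈ C, (m, id) ∈ ((e.config t).state p).urBroadcast →
      p ∈ effectiveCasters e m id by
    intro p hp
    obtain ⟨hp, t, ht⟩ := Finset.mem_filter.1 hp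
    exact H t p hp ht
  intro t
  induction t using Nat.strong_induction_on with
  | _ t ih =>
    intro p hp ht
    obtain ⟨u, hut, h3, h4⟩ := exists_new_of_mem (fun t => ((e.config t).state p).urBroadcast)
      (by simp only [start_state]) ht
    rcases (new_urBroadcast e h3 h4).2.1 with h5 | ⟨h5, -⟩
    · exact Finset.mem_filter.2 ⟨hp, u, h5⟩
    · exfalso
      -- The correct senders heard by this forwarder ur-broadcast strictly before `t`, hence are
      -- effective casters by induction; there are then enough of them to contradict `h2`.
      have := numReceived_le_of_correct (C := C) (s := (e.config (u + 1)).state p) (m := m)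
        (id := id) (S := effectiveCasters e m id) (fun q hq hr => by
          obtain ⟨v, hv, hr⟩ := mem_urBroadcast_of_received e hq hr
          exact ih v (by omega) q hq hr)
      omega

theorem broadcasters_card_of_deliver {t : ℕ} {p : Fin n} {m : M} {id : Id}
    (h : e.history.deliver t p m id) : qd + C.card ≤ (broadcasters e m id).card + n := by
  have h1 := (deliver_spec e h).2.1
  have h2 := numReceived_le_of_correct (C := C) (s := (e.config (t + 1)).state p) (m := m)
    (id := id) (S := broadcasters e m id) (fun q hq hr => mem_broadcasters_of_received e hq hr)
  omega

theorem effectiveCasters_card_of_deliver (hq : qf ≤ qd) {t : ℕ} {p : Fin n} {m : M} {id : Id}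
    (h : e.history.deliver t p m id) : qf + C.card ≤ (effectiveCasters e m id).card + n := by
  rcases broadcasters_subset_or e m id with h1 | h1
  · have := Finset.card_le_card h1
    have := broadcasters_card_of_deliver e h
    omega
  · exact h1

/-- Since `n - c < qf`, Byzantine processes alone cannot trigger forwarding: a message without
correct casters never spreads among correct processes. -/
theorem broadcasters_eq_empty (hqf : n < qf + C.card) {m m' : M} {id : Id}
    (hno : NoConflictingCast e.history C m id) (hne : m' ≠ m) : broadcasters e m' id = ∅ := by
  classical
  have h0 : effectiveCasters e m' id = ∅ := by
    rw [Finset.eq_empty_iff_forall_notMem]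
    intro p hp
    obtain ⟨hp, t, h1, -⟩ := Finset.mem_filter.1 hp
    exact hne (hno p hp t m' h1)
  rcases broadcasters_subset_or e m' id with h | h
  · rw [h0] at h; exact Finset.subset_empty.1 h
  · rw [h0, Finset.card_empty] at h; omega

/-- A cast can be ignored only because something with the same identity was already ur-broadcast,
and here that can only be `m` itself. -/
theorem mem_broadcasters_of_cast (hqf : n < qf + C.card) {m : M} {id : Id}
    (hno : NoConflictingCast e.history C m id) {p : Fin n} (hp : p ∈ C) {t : ℕ}
    (h : e.history.cast t p m id) : p ∈ broadcasters e m id := by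
  classical
  obtain ⟨lost, hev⟩ := h
  have hs := e.step t
  rw [hev] at hs
  obtain ⟨-, -, -, hs⟩ := hs
  obtain ⟨m', hm'⟩ := exists_mem_urBroadcast_sfCast ((e.config t).state p) m id
  have hmem : p ∈ broadcasters e m' id := by
    refine Finset.mem_filter.2 ⟨hp, t + 1, ?_⟩
    rw [hs]
    simp only [afterHandler, Function.update_self]
    exact hm'
  by_cases hne : m' = m
  · rwa [hne] at hmem
  · rw [broadcasters_eq_empty e hqf hno hne] at hmem; simp at hmem

/-! ### Counting receptions -/

/-- `q` eventually receives `MSG(m, id)` from `p`. -/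
def EventuallyReceives (m : M) (id : Id) (p q : Fin n) : Prop :=
  ∃ t, (p, m, id) ∈ ((e.config t).state q).received

open Classical in
/-- The correct processes from which `q` eventually receives `MSG(m, id)`. -/
noncomputable def correctSenders (m : M) (id : Id) (q : Fin n) : Finset (Fin n) :=
  {p ∈ broadcasters e m id | EventuallyReceives e m id p q}

open Classical in
theorem card_receivers {m : M} {id : Id} {p : Fin n} (hp : p ∈ broadcasters e m id) :
    C.card ≤ ({q ∈ C | EventuallyReceives e m id p q}).card + tm := by
  obtain ⟨hp, t, ht⟩ := Finset.mem_filter.1 hp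
  obtain ⟨u, -, h1, h2⟩ := exists_new_of_mem (fun t => ((e.config t).state p).urBroadcast)
    (by simp only [start_state]) ht
  obtain ⟨-, -, lost, hl, hnet⟩ := new_urBroadcast e h1 h2
  have hsub : C \ lost ⊆ {q ∈ C | EventuallyReceives e m id p q} := by
    intro q hq
    obtain ⟨hq, hql⟩ := Finset.mem_sdiff.1 hq
    refine Finset.mem_filter.2 ⟨hq, ?_⟩
    obtain ⟨t', -, lost', hev⟩ := e.fair (u + 1) ⟨p, q, (m, id)⟩ (hnet q hql) hp hq
    have hs := e.step t'
    rw [hev] at hs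
    obtain ⟨-, -, -, rest, -, hs⟩ := hs
    refine ⟨t' + 1, ?_⟩
    rw [hs]
    simp only [afterHandler, Function.update_self]
    change _ ∈ (sfReceive qd qf single _ p m id).state.received
    rw [sfReceive_received]
    exact Set.mem_insert _ _
  have h3 := Finset.card_le_card hsub
  have h4 := Finset.le_card_sdiff lost C
  omega

/-- Finitely many receptions are all complete at the supremum of their times, since received sets
only grow. -/
theorem exists_numReceived_ge (m : M) (id : Id) (q : Fin n) :
    ∃ t, (correctSenders e m id q).card ≤ ((e.config t).state q).numReceived m id := by
  classical
  have h : ∀ p ∈ correctSenders e m id q, EventuallyReceives e m id p q :=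
    fun p hp => (Finset.mem_filter.1 hp).2
  choose! f hf using h
  refine ⟨(correctSenders e m id q).sup f, ?_⟩
  rw [← Set.ncard_coe_finset]
  refine Set.ncard_le_ncard (fun p hp => ?_) (Set.toFinite _)
  exact received_mono e q (Finset.le_sup (f := f) hp) (hf p hp)

/-- Double counting of the eventual receptions, each ur-broadcaster missing at most `tm` members of
`C`. -/
theorem mul_card_le_sum_correctSenders (m : M) (id : Id) :
    (broadcasters e m id).card * C.card ≤
      ∑ q ∈ C, (correctSenders e m id q).card + (broadcasters e m id).card * tm := by
  classical
  have h1 := Finset.sum_card_bipartiteAbove_eq_sum_card_bipartiteBelow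
    (s := broadcasters e m id) (t := C) (EventuallyReceives e m id)
  have h2 : (broadcasters e m id).card * C.card ≤
      ∑ p ∈ broadcasters e m id,
        (({q ∈ C | EventuallyReceives e m id p q}).card + tm) := by
    rw [← smul_eq_mul]
    exact Finset.card_nsmul_le_sum _ _ _ fun p hp => card_receivers e hp
  rw [Finset.sum_add_distrib, Finset.sum_const, smul_eq_mul] at h2
  simp only [Finset.bipartiteAbove, Finset.bipartiteBelow] at h1
  rw [h1] at h2
  exact h2

/-- Every correct process that receives `MSG(m, id)` from `qf` processes ur-broadcasts it. -/
def Forwards (m : M) (id : Id) : Prop :=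
  ∀ q ∈ C, ∀ t, qf ≤ ((e.config t).state q).numReceived m id → q ∈ broadcasters e m id

theorem forwards_of_not_single (hqf : 1 ≤ qf) (hs : single = false) (m : M) (id : Id) :
    Forwards e m id := by
  classical
  intro q hq t h
  exact Finset.mem_filter.2 ⟨hq, t, (forwarded_of_numReceived e hqf h).1 hs⟩

/-- The guard of `single` can be closed only by an earlier ur-broadcast with identity `id`, which
must be of `m`, as no other message has correct ur-broadcasters. -/
theorem forwards_of_noConflictingCast (hqf : 1 ≤ qf) (hb : n < qf + C.card) {m : M} {id : Id}
    (hno : NoConflictingCast e.history C m id) : Forwards e m id := by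
  classical
  intro q hq t h
  obtain ⟨m', hm'⟩ := (forwarded_of_numReceived e hqf h).2
  have hmem : q ∈ broadcasters e m' id := Finset.mem_filter.2 ⟨hq, t, hm'⟩
  by_cases hne : m' = m
  · rwa [hne] at hmem
  · rw [broadcasters_eq_empty e hb hno hne] at hmem; simp at hmem

theorem correctSenders_card_of_notMem (hqf : 1 ≤ qf) {m : M} {id : Id} (hF : Forwards e m id)
    {q : Fin n} (hq : q ∈ C) (h : q ∉ broadcasters e m id) :
    (correctSenders e m id q).card ≤ qf - 1 := by
  by_contra! hcon
  obtain ⟨t, ht⟩ := exists_numReceived_ge e m id q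
  exact h (hF q hq t (by omega))

theorem correctSenders_card_le (m : M) (id : Id) (q : Fin n) :
    (correctSenders e m id q).card ≤ (broadcasters e m id).card := by
  classical exact Finset.card_le_card (Finset.filter_subset _ _)

open Classical in
/-- The correct processes that eventually receive `MSG(m, id)` from `qd` correct processes. -/
noncomputable def quorumReceivers (m : M) (id : Id) : Finset (Fin n) :=
  {q ∈ C | qd ≤ (correctSenders e m id q).card}

theorem quorumReceivers_subset_broadcasters (hq : qf ≤ qd) {m : M} {id : Id}
    (hF : Forwards e m id) : quorumReceivers e m id ⊆ broadcasters e m id := by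
  classical
  intro q hmem
  obtain ⟨hqC, h⟩ := Finset.mem_filter.1 hmem
  obtain ⟨t, ht⟩ := exists_numReceived_ge e m id q
  exact hF q hqC t (by omega)

theorem exists_deliver_of_mem_quorumReceivers (hqd : 1 ≤ qd) {m : M} {id : Id} {q : Fin n}
    (h : q ∈ quorumReceivers e m id) : q ∈ C ∧ ∃ u m', e.history.deliver u q m' id := by
  classical
  obtain ⟨hqC, h⟩ := Finset.mem_filter.1 h
  obtain ⟨t, ht⟩ := exists_numReceived_ge e m id q
  obtain ⟨m', hm'⟩ := exists_delivered_of_numReceived e hqd (h.trans ht)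
  obtain ⟨u, hu⟩ := exists_deliver_of_mem_delivered e hm'
  exact ⟨hqC, u, m', hu⟩

theorem exists_deliver_of_noConflictingCast (hqf : n < qf + C.card) (hq : qf ≤ qd)
    {m : M} {id : Id} (hno : NoConflictingCast e.history C m id) {q : Fin n}
    (h : ∃ u m', e.history.deliver u q m' id) : ∃ u, e.history.deliver u q m id := by
  obtain ⟨u, m', hu⟩ := h
  by_cases hne : m' = m
  · exact ⟨u, hne ▸ hu⟩
  · have := broadcasters_card_of_deliver e hu
    rw [broadcasters_eq_empty e hqf hno hne, Finset.card_empty] at this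
    omega

/-- Splitting the receptions between ur-broadcasters and the other correct processes. -/
theorem card_mul_le_of_forwards (hqf : 1 ≤ qf) {m : M} {id : Id} (hF : Forwards e m id) {s : ℕ}
    (hs : ∑ q ∈ broadcasters e m id, (correctSenders e m id q).card ≤ s) :
    ((broadcasters e m id).card : ℤ) * ((C.card : ℤ) - tm) ≤
      s + ((C.card : ℤ) - (broadcasters e m id).card) * ((qf : ℤ) - 1) := by
  classical
  have h1 := mul_card_le_sum_correctSenders e m id
  rw [← Finset.sum_sdiff (broadcasters_subset e m id)] at h1
  have h2 : ∑ q ∈ C \ broadcasters e m id, (correctSenders e m id q).card ≤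
      (C \ broadcasters e m id).card * (qf - 1) := by
    rw [← smul_eq_mul]
    exact Finset.sum_le_card_nsmul _ _ _ fun q hq =>
      correctSenders_card_of_notMem e hqf hF (Finset.mem_sdiff.1 hq).1 (Finset.mem_sdiff.1 hq).2
  have h3 := Finset.card_sdiff_add_card_eq_card (broadcasters_subset e m id)
  zify [hqf] at h1 h2 h3 hs
  have h4 : ((C \ broadcasters e m id).card : ℤ) = C.card - (broadcasters e m id).card := by
    linarith
  rw [h4] at h2
  linarith

/-- The crude case, where an ur-broadcaster may hear all the others; it does not involve quorums and
serves to bound the number of ur-broadcasters from below. -/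
theorem card_mul_le_sq (hqf : 1 ≤ qf) {m : M} {id : Id} (hF : Forwards e m id) :
    ((broadcasters e m id).card : ℤ) * ((C.card : ℤ) - tm) ≤
      ((broadcasters e m id).card : ℤ) ^ 2 +
        ((C.card : ℤ) - (broadcasters e m id).card) * ((qf : ℤ) - 1) := by
  have h := card_mul_le_of_forwards e hqf hF (s := (broadcasters e m id).card ^ 2) (by
    rw [pow_two, ← smul_eq_mul]
    exact Finset.sum_le_card_nsmul _ _ _ fun q _ => correctSenders_card_le e m id q)
  push_cast at h
  exact h

theorem card_mul_le_quorum (hqf : 1 ≤ qf) (hq : qf ≤ qd) {m : M} {id : Id}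
    (hF : Forwards e m id) :
    ((broadcasters e m id).card : ℤ) * ((C.card : ℤ) - tm) ≤
      (quorumReceivers e m id).card * (broadcasters e m id).card +
        ((broadcasters e m id).card - (quorumReceivers e m id).card) * ((qd : ℤ) - 1) +
        ((C.card : ℤ) - (broadcasters e m id).card) * ((qf : ℤ) - 1) := by
  classical
  have hsub := quorumReceivers_subset_broadcasters e hq hF
  have h := card_mul_le_of_forwards e hqf hF
    -- Ur-broadcasters outside the quorum set hear at most `qd - 1` correct senders; those inside
    -- may hear all of them.
    (s := (broadcasters e m id \ quorumReceivers e m id).card * (qd - 1) +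
      (quorumReceivers e m id).card * (broadcasters e m id).card) (by
    rw [← Finset.sum_sdiff hsub, ← smul_eq_mul, ← smul_eq_mul]
    refine add_le_add (Finset.sum_le_card_nsmul _ _ _ fun q hmem => ?_)
      (Finset.sum_le_card_nsmul _ _ _ fun q _ => correctSenders_card_le e m id q)
    obtain ⟨h1, h2⟩ := Finset.mem_sdiff.1 hmem
    by_contra! hcon
    exact h2 (Finset.mem_filter.2 ⟨broadcasters_subset e m id h1, by omega⟩))
  have h3 := Finset.card_sdiff_add_card_eq_card hsub
  have hqd : 1 ≤ qd := by omega
  zify [hqd] at h h3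
  have h4 : ((broadcasters e m id \ quorumReceivers e m id).card : ℤ) =
    (broadcasters e m id).card - (quorumReceivers e m id).card := by linarith
  rw [h4] at h
  linarith

end Executions

/-! ### Arithmetic of the thresholds -/

/-- Put `f(y) = y² - αy + (qf - 1)(n - tb)`. The hypotheses say `f(qd - 1) < 0` and `f(qd - 1 - tb)
≤ 0`, so by convexity `f < 0` on the half-open interval between them, whereas the count gives `f(x)
≥ 0`. -/
theorem le_card_of_quadratic {n tb tm qd qf c x : ℤ} (hc : n - tb ≤ c) (htb : 0 ≤ tb)
    (hq : qf + tb ≤ qd)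
    (h3 : (n + qf - tb - tm - 1) * (qd - 1) - (qf - 1) * (n - tb) - (qd - 1) ^ 2 > 0)
    (h4 : (n + qf - tb - tm - 1) * (qd - 1 - tb) - (qf - 1) * (n - tb) - (qd - 1 - tb) ^ 2 ≥ 0)
    (hx : qd - tb ≤ x) (h : x * (c - tm) ≤ x ^ 2 + (c - x) * (qf - 1)) : qd ≤ x := by
  by_contra! hlt
  -- Replacing `c` by its lower bound `n - tb` is allowed because the coefficient of `c` is `-(x -
  -- qf + 1) ≤ 0` once everything is moved to the smaller side.
  have hf : 0 ≤ x ^ 2 - (n + qf - tb - tm - 1) * x + (qf - 1) * (n - tb) := by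
    nlinarith [mul_nonneg (sub_nonneg.2 hc) (show 0 ≤ x - qf + 1 by linarith)]
  have ha : 0 ≤ qd - 1 - x := by linarith
  have hb : 0 < x - (qd - 1 - tb) := by linarith
  nlinarith [mul_nonneg ha hb.le, mul_nonneg ha h4, mul_pos hb h3,
    mul_nonneg (mul_nonneg ha hb.le) htb]

/-- Solving for `l` gives `l ≥ (x(c - tm - qd + qf) - c(qf - 1)) / (x - qd + 1)`. The right side is
nonincreasing in `x` by `hf`, so its value at `x = c` is a lower bound, namely `c(1 - tm / (c - qd +
1))`. -/
theorem ceil_le_of_quorum {n tb tm qd qf c x l : ℤ} (hc : n - tb ≤ c) (htb : 0 ≤ tb)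
    (hq : qf + tb ≤ qd) (hcq : qd ≤ c) (hxc : x ≤ c)
    (h3 : (n + qf - tb - tm - 1) * (qd - 1) - (qf - 1) * (n - tb) - (qd - 1) ^ 2 > 0)
    (hx : qd ≤ x)
    (h : x * (c - tm) ≤ l * x + (x - l) * (qd - 1) + (c - x) * (qf - 1)) :
    ⌈(c : ℚ) * (1 - (tm : ℚ) / ((c : ℚ) - qd + 1))⌉ ≤ l := by
  -- Nondecreasing in `c` as `qf ≤ qd`; at `c = n - tb` it is `h3`.
  have hf : 0 ≤ (c - tm - qd + qf) * (qd - 1) - c * (qf - 1) := by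
    nlinarith [mul_nonneg (sub_nonneg.2 hc) (show 0 ≤ qd - qf by linarith)]
  have hpos : 0 < c - qd + 1 := by linarith
  have hposx : 0 < x - qd + 1 := by linarith
  have key : c * (c - qd + 1 - tm) ≤ l * (c - qd + 1) := by
    refine le_of_mul_le_mul_right ?_ hposx
    nlinarith [mul_nonneg hf (sub_nonneg.2 hxc), mul_le_mul_of_nonneg_right h hpos.le]
  rw [Int.ceil_le]
  have hposq : (0 : ℚ) < (c : ℚ) - qd + 1 := by exact_mod_cast hpos
  have keyq : (c : ℚ) * (c - qd + 1 - tm) ≤ l * (c - qd + 1) := by exact_mod_cast key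
  rw [← sub_nonneg]
  have : (l : ℚ) - c * (1 - tm / (c - qd + 1)) =
      (l * (c - qd + 1) - c * (c - qd + 1 - tm)) / (c - qd + 1) := by
    field_simp
  rw [this]
  exact div_nonneg (sub_nonneg.2 keyq) hposq.le

/-! ### Global delivery -/

/-- Common core of weak and strong global delivery: the value of `single` matters only through
`Forwards`. -/
theorem quorumReceivers_card_ge {M Id : Type*} {n tb tm qd qf : ℕ} {single : Bool}
    {C : Finset (Fin n)} (hbyz : n ≤ C.card + tb)
    (hqf : tb + 1 ≤ qf) (hqd : qf + tb ≤ qd) (hcd : qd ≤ C.card)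
    (h3 : sfAlpha n tb tm qf * ((qd : ℤ) - 1) - ((qf : ℤ) - 1) * ((n : ℤ) - tb)
      - ((qd : ℤ) - 1) ^ 2 > 0)
    (h4 : sfAlpha n tb tm qf * ((qd : ℤ) - 1 - tb) - ((qf : ℤ) - 1) * ((n : ℤ) - tb)
      - ((qd : ℤ) - 1 - tb) ^ 2 ≥ 0)
    (e : Execution (SigFreeKLCast n M Id qd qf single) C tm) {m : M} {id : Id}
    (hF : Forwards e m id) {t : ℕ} {p : Fin n} (h : e.history.deliver t p m id) :
    ⌈(C.card : ℚ) * (1 - (tm : ℚ) / ((C.card : ℚ) - qd + 1))⌉ ≤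
      ((quorumReceivers e m id).card : ℤ) := by
  unfold sfAlpha at h3 h4
  have h5 := broadcasters_card_of_deliver e h
  have hx : (qd : ℤ) ≤ (broadcasters e m id).card :=
    le_card_of_quadratic (by omega) (by omega) (by omega) h3 h4 (by omega)
      (card_mul_le_sq e (by omega) hF)
  have := ceil_le_of_quorum (n := n) (tb := tb) (c := C.card) (by omega) (by omega) (by omega)
    (by omega) (by exact_mod_cast Finset.card_le_card (broadcasters_subset e m id)) h3 hx
    (card_mul_le_quorum e (by omega) (by omega) hF)
  simpa only [Int.cast_natCast] using this

end KLCast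

/-! ### The main theorem -/

theorem theorem1 {M Id : Type*} (n tb tm qd qf : ℕ) (single : Bool)
    -- `C` is the set of correct processes, `c` its cardinality; at most `tb` processes are Byzantine
    (C : Finset (Fin n)) (c : ℕ) (hc : c = C.card) (hbyz : n ≤ c + tb)
    -- the four assumptions on the parameters
    (h1 : (c : ℤ) - tm ≥ qd ∧ (qd : ℤ) ≥ qf + tb ∧ (qf : ℤ) + tb ≥ 2 * tb + 1)
    (h2 : KLCast.sfAlpha n tb tm qf ^ 2 - 4 * ((qf : ℤ) - 1) * ((n : ℤ) - tb) ≥ 0)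
    (h3 : KLCast.sfAlpha n tb tm qf * ((qd : ℤ) - 1) - ((qf : ℤ) - 1) * ((n : ℤ) - tb)
      - ((qd : ℤ) - 1) ^ 2 > 0)
    (h4 : KLCast.sfAlpha n tb tm qf * ((qd : ℤ) - 1 - tb) - ((qf : ℤ) - 1) * ((n : ℤ) - tb)
      - ((qd : ℤ) - 1 - tb) ^ 2 ≥ 0)
    -- any execution of the algorithm
    (e : KLCast.Execution (KLCast.SigFreeKLCast n M Id qd qf single) C tm) :
    KLCast.Validity e.history C ((qf : ℤ) - n + c) ∧
    KLCast.NoDuplication e.history C ∧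
    KLCast.ConditionalNoDuplicity e.history C
      ((qf : ℚ) > ((n : ℚ) + tb) / 2 ∨ (single = true ∧ (qd : ℚ) > ((n : ℚ) + tb) / 2)) ∧
    KLCast.LocalDelivery e.history C
      (⌊((c : ℚ) * ((qf : ℚ) - 1)) / ((c : ℚ) - tm - qd + qf)⌋ + 1) ∧
    (single = false →
      KLCast.WeakGlobalDelivery e.history C ⌈(c : ℚ) * (1 - (tm : ℚ) / ((c : ℚ) - qd + 1))⌉) ∧
    (single = true →
      KLCast.StrongGlobalDelivery e.history C
        ⌈(c : ℚ) * (1 - (tm : ℚ) / ((c : ℚ) - qd + 1))⌉) := by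
  subst hc
  obtain ⟨hcd, hqd, hqf⟩ := h1
  have hb : n < qf + C.card := by omega
  have hle : qf ≤ qd := by omega
  -- Disjointness inside `C` gives `2(q - n + c) ≤ c`, hence `2q ≤ 2n - c ≤ n + tb`.
  have hdisj : ∀ (A B : Finset (Fin n)) (q : ℕ), A ⊆ C → B ⊆ C → Disjoint A B →
      q + C.card ≤ A.card + n → q + C.card ≤ B.card + n → ¬ ((q : ℚ) > ((n : ℚ) + tb) / 2) := by
    classical
    intro A B q hA hB hAB h1 h2 h3
    have h4 := Finset.card_le_card (Finset.union_subset hA hB)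
    rw [Finset.card_union_of_disjoint hAB] at h4
    have h5 : (n : ℚ) + tb < 2 * q := by linarith
    have h6 : n + tb < 2 * q := by exact_mod_cast h5
    omega
  refine ⟨?_, ?_, ?_, ?_, ?_, ?_⟩
  · intro p _ t m id h
    have h1 := KLCast.effectiveCasters_card_of_deliver e hle h
    have h2 := KLCast.effectiveCasters_card_le e m id
    omega
  · intro p _ t t' m m' id h h'
    exact KLCast.deliver_unique e h h'
  · intro hδ p _ q _ _ t t' m m' id h h'
    by_contra hne
    rcases hδ with hδ | ⟨hs, hδ⟩
    · exact hdisj _ _ qf (KLCast.effectiveCasters_subset e m id)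
        (KLCast.effectiveCasters_subset e m' id) (KLCast.effectiveCasters_disjoint e id hne)
        (KLCast.effectiveCasters_card_of_deliver e hle h)
        (KLCast.effectiveCasters_card_of_deliver e hle h') hδ
    · refine hdisj _ _ qd (KLCast.broadcasters_subset e m id)
        (KLCast.broadcasters_subset e m' id) ?_
        (KLCast.broadcasters_card_of_deliver e h) (KLCast.broadcasters_card_of_deliver e h') hδ
      rw [Finset.disjoint_left]
      intro r hr hr'
      classical
      obtain ⟨-, u, hu⟩ := Finset.mem_filter.1 hr
      obtain ⟨-, v, hv⟩ := Finset.mem_filter.1 hr'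
      exact hne (KLCast.urBroadcast_unique e hs
        (KLCast.urBroadcast_mono e r (le_max_left u v) hu)
        (KLCast.urBroadcast_mono e r (le_max_right u v) hv))
  · intro m id hk hno
    have hF := KLCast.forwards_of_noConflictingCast e (by omega) hb hno
    have hx : ({q | q ∈ C ∧ ∃ t, e.history.cast t q m id} : Set (Fin n)).ncard ≤
        (KLCast.broadcasters e m id).card := by
      rw [← Set.ncard_coe_finset]
      refine Set.ncard_le_ncard ?_ (Set.toFinite _)
      rintro q ⟨hq, t, ht⟩
      exact KLCast.mem_broadcasters_of_cast e hb hno hq ht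
    by_cases hL : (KLCast.quorumReceivers e m id).Nonempty
    · obtain ⟨q, hq⟩ := hL
      obtain ⟨hqC, hd⟩ := KLCast.exists_deliver_of_mem_quorumReceivers e (by omega) hq
      exact ⟨q, hqC, KLCast.exists_deliver_of_noConflictingCast e hb hle hno hd⟩
    · exfalso
      -- With no quorum receiver the count becomes `x(c - tm - qd + qf) ≤ c(qf - 1)`, which
      -- contradicts `x` exceeding the floor.
      have h5 := KLCast.card_mul_le_quorum e (by omega) hle hF
      rw [Finset.not_nonempty_iff_eq_empty] at hL
      rw [hL, Finset.card_empty] at h5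
      have hpos : (0 : ℚ) < (C.card : ℚ) - tm - qd + qf := by
        have : (0 : ℤ) < (C.card : ℤ) - tm - qd + qf := by omega
        exact_mod_cast this
      have h6 : ⌊((C.card : ℚ) * ((qf : ℚ) - 1)) / ((C.card : ℚ) - tm - qd + qf)⌋ <
          ((KLCast.broadcasters e m id).card : ℤ) := by
        have : (({q | q ∈ C ∧ ∃ t, e.history.cast t q m id} : Set (Fin n)).ncard : ℤ) ≤
          (KLCast.broadcasters e m id).card := by exact_mod_cast hx
        linarith
      rw [Int.floor_lt, div_lt_iff₀ hpos] at h6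
      have h7 : ((C.card : ℤ) * ((qf : ℤ) - 1)) <
          (KLCast.broadcasters e m id).card * ((C.card : ℤ) - tm - qd + qf) := by
        exact_mod_cast h6
      push_cast at h5
      linarith
  · intro hs p _ t m id h
    have hF := KLCast.forwards_of_not_single e (by omega) hs m id
    refine (KLCast.quorumReceivers_card_ge hbyz (by omega) (by omega) (by omega) h3 h4 e hF h).trans ?_
    rw [← Set.ncard_coe_finset]
    exact_mod_cast Set.ncard_le_ncard
      (fun q hq => KLCast.exists_deliver_of_mem_quorumReceivers e (by omega) hq) (Set.toFinite _)
  · intro _ p _ t m id h hno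
    have hF := KLCast.forwards_of_noConflictingCast e (by omega) hb hno
    refine (KLCast.quorumReceivers_card_ge hbyz (by omega) (by omega) (by omega) h3 h4 e hF h).trans ?_
    rw [← Set.ncard_coe_finset]
    refine Int.ofNat_le.2 (Set.ncard_le_ncard (fun q hq => ?_) (Set.toFinite _))
    obtain ⟨hqC, hd⟩ := KLCast.exists_deliver_of_mem_quorumReceivers e (by omega) hq
    exact ⟨hqC, KLCast.exists_deliver_of_noConflictingCast e hb hle hno hd⟩
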